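/- For sequences $x=(x_n)_{n\ge1}$, $y=(y_n)_{n\ge1}$ in $[-1,1]$ put $D(x,y)=\sup_{n\ge1}2^{-n}|x_n-y_n|$, and let $\sigma\colon[-1,1]^{\mathbb N}\to[-1,1]^{\mathbb N}$, $\sigma(x)_n=x_{n+1}$, be the shift. Let $(s_k)_{k\ge1}$ be any sequence of real numbers with $0<s_1<s_2<\cdots$ and $\lim_{k\to\infty}s_k=1$, and put \[ S=\{-1,1\}\cup\{-s_k\colon k\ge1\}\cup\{s_k\colon k\ge1\}. \] Let $X$ be the set of all $x=(x_n)_{n\ge1}\in S^{\mathbb N}$ such that (i) $|x_1|\le|x_2|\le\cdots$; (ii) for all $n,k\ge1$, if $x_n=s_k$, then $x_{n+j}=-s_k$ for all $1\le j\le k$; (iii) for all $n\ge1$, if $x_n=1$, then $x_{n+j}=-1$ for all $j\ge1$. Then $\sigma(X)\subset X$, the set $X$ is compact with respect to $D$, the map $f=\sigma|_X\colon X\to X$ is continuous, and $f$ has the s-limit shadowing property: for every $\epsilon>0$ there is $\delta>0$ such that for every sequence $(\xi_i)_{i\ge0}$ in $X$ with $D(f(\xi_i),\xi_{i+1})\le\delta$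 for all $i\ge0$ and $\lim_{i\to\infty}D(f(\xi_i),\xi_{i+1})=0$ there is $x\in X$ with $D(f^i(x),\xi_i)\le\epsilon$ for all $i\ge0$ and $\lim_{i\to\infty}D(f^i(x),\xi_i)=0$. -/

import Mathlib

open Filter Topology

noncomputable section

namespace SLimit

/-! ### s-limit shadowing -/

section Shadowing

variable {Y : Type*} [MetricSpace Y]

/-- `ξ` is a `δ`-limit-pseudo orbit of `f`. -/
def IsLimitPseudoOrbit (f : Y → Y) (δ : ℝ) (ξ : ℕ → Y) : Prop :=
  (∀ i, dist (f (ξ i)) (ξ (i + 1)) ≤ δ) ∧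
    Tendsto (fun i => dist (f (ξ i)) (ξ (i + 1))) atTop (𝓝 0)

/-- `ξ` is `ε`-limit shadowed by the point `x`. -/
def IsLimitShadowedBy (f : Y → Y) (ε : ℝ) (ξ : ℕ → Y) (x : Y) : Prop :=
  (∀ i, dist (f^[i] x) (ξ i) ≤ ε) ∧
    Tendsto (fun i => dist (f^[i] x) (ξ i)) atTop (𝓝 0)

/-- The s-limit shadowing property. -/
def HasSLimitShadowing (f : Y → Y) : Prop :=
  ∀ ε : ℝ, 0 < ε → ∃ δ : ℝ, 0 < δ ∧
    ∀ ξ : ℕ → Y, IsLimitPseudoOrbit f δ ξ → ∃ x : Y, IsLimitShadowedBy f ε ξ x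

end Shadowing

/-! ### The space `[-1,1]^ℕ` with its metric and its shift -/

/-- The space of sequences in `[-1,1]`. The coordinate `x_n`, `n ≥ 1`, of the mathematical text
is `x (n - 1)` here, so coordinates are numbered from `0`. -/
def SeqSpace : Type := ℕ → Set.Icc (-1 : ℝ) 1

/-- The coordinate of `x` at position `n` (numbered from `0`), as a real number. -/
def SeqSpace.coord (x : SeqSpace) (n : ℕ) : ℝ := (x n : Set.Icc (-1 : ℝ) 1)

/-- The distance `D(x,y) = sup_n 2^{-n} |x_n - y_n|`, `n ≥ 1`. With positions numbered from `0`,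
the weight at position `n` is `2^{-(n+1)}`. -/
def seqDist (x y : SeqSpace) : ℝ :=
  ⨆ n : ℕ, (1 / 2 : ℝ) ^ (n + 1) * |x.coord n - y.coord n|

theorem SeqSpace.abs_coord_sub_le (x y : SeqSpace) (n : ℕ) : |x.coord n - y.coord n| ≤ 2 := by
  have hx : -1 ≤ x.coord n ∧ x.coord n ≤ 1 := (x n).2
  have hy : -1 ≤ y.coord n ∧ y.coord n ≤ 1 := (y n).2
  rw [abs_le]
  constructor <;> linarith [hx.1, hx.2, hy.1, hy.2]

theorem seqDist_bddAbove (x y : SeqSpace) :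
    BddAbove (Set.range fun n : ℕ => (1 / 2 : ℝ) ^ (n + 1) * |x.coord n - y.coord n|) := by
  refine ⟨2, ?_⟩
  rintro _ ⟨n, rfl⟩
  have h1 : (1 / 2 : ℝ) ^ (n + 1) ≤ 1 := pow_le_one₀ (by norm_num) (by norm_num)
  have h2 := SeqSpace.abs_coord_sub_le x y n
  have h3 := abs_nonneg (x.coord n - y.coord n)
  change (1 / 2 : ℝ) ^ (n + 1) * |x.coord n - y.coord n| ≤ 2
  nlinarith

theorem le_seqDist (x y : SeqSpace) (n : ℕ) :
    (1 / 2 : ℝ) ^ (n + 1) * |x.coord n - y.coord n| ≤ seqDist x y :=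
  le_ciSup (seqDist_bddAbove x y) n

instance : MetricSpace SeqSpace where
  dist := seqDist
  dist_self x := by
    change seqDist x x = 0
    simp [seqDist]
  dist_comm x y := by
    change seqDist x y = seqDist y x
    simp only [seqDist, abs_sub_comm]
  dist_triangle x y z := by
    change seqDist x z ≤ seqDist x y + seqDist y z
    refine ciSup_le fun n => ?_
    have h1 := le_seqDist x y n
    have h2 := le_seqDist y z n
    have h3 : (1 / 2 : ℝ) ^ (n + 1) * |x.coord n - z.coord n| ≤
        (1 / 2 : ℝ) ^ (n + 1) * (|x.coord n - y.coord n| + |y.coord n - z.coord n|) :=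
      mul_le_mul_of_nonneg_left (abs_sub_le _ _ _) (by positivity)
    linarith
  eq_of_dist_eq_zero := by
    intro x y h
    change seqDist x y = 0 at h
    funext n
    have h1 := le_seqDist x y n
    rw [h] at h1
    have h2 : (0 : ℝ) < (1 / 2 : ℝ) ^ (n + 1) := by positivity
    have h3 : |x.coord n - y.coord n| ≤ 0 := by
      by_contra hc
      push Not at hc
      exact absurd h1 (not_le.mpr (mul_pos h2 hc))
    exact Subtype.ext (sub_eq_zero.mp (abs_nonpos_iff.mp h3))

/-- The shift map on `[-1,1]^ℕ`. -/
def shift (x : SeqSpace) : SeqSpace := fun n => x (n + 1)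

/-! ### The subshift -/

/-- The alphabet `S = {-1, 1} ∪ {-s_k : k ≥ 1} ∪ {s_k : k ≥ 1}`. -/
def alphabet (s : ℕ → ℝ) : Set ℝ :=
  {-1, 1} ∪ {a | ∃ k : ℕ, 1 ≤ k ∧ a = -s k} ∪ {a | ∃ k : ℕ, 1 ≤ k ∧ a = s k}

/-- The subshift `X ⊆ S^ℕ` attached to the sequence `s_1, s_2, …` (the value `s 0` is not used). -/
def subshift (s : ℕ → ℝ) : Set SeqSpace :=
  {x | (∀ n, x.coord n ∈ alphabet s) ∧
    (∀ n, |x.coord n| ≤ |x.coord (n + 1)|) ∧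
    (∀ n k : ℕ, 1 ≤ k → x.coord n = s k →
      ∀ j : ℕ, 1 ≤ j → j ≤ k → x.coord (n + j) = -s k) ∧
    (∀ n : ℕ, x.coord n = 1 → ∀ j : ℕ, 1 ≤ j → x.coord (n + j) = -1)}

theorem mapsTo_shift (s : ℕ → ℝ) : Set.MapsTo shift (subshift s) (subshift s) := by
  rintro x ⟨h1, h2, h3, h4⟩
  refine ⟨fun n => h1 (n + 1), fun n => h2 (n + 1), fun n k hk hn j hj hjk => ?_,
    fun n hn j hj => ?_⟩
  · have := h3 (n + 1) k hk hn j hj hjk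
    rwa [add_right_comm] at this
  · have := h4 (n + 1) hn j hj
    rwa [add_right_comm] at this

/-- The map `f = σ|_X : X → X`. -/
def subshiftMap (s : ℕ → ℝ) : subshift s → subshift s :=
  (mapsTo_shift s).restrict shift (subshift s) (subshift s)

end SLimit

end

/-!
A point of the subshift is a sequence of signs together with a sequence of levels in the compact
space `ℕ∞`, where level `⊤` stands for the absolute value `1`. The rules of the subshift are closed
conditions on such pairs, and passing from pairs to points is continuous, so the subshift is
compact.

Since the coordinate of `ξ i` at `n` is close to the initial coordinate of `ξ (i + n)`, shadowing a
pseudo-orbit amounts to following the sequence of its initial coordinates. That sequence obeys the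
rules for the levels truncated at some large `K`, and, for each `N`, it eventually obeys them for
the levels truncated at `N`. In particular its levels are eventually monotone up to every
truncation, so they converge in `ℕ∞` to some `c`. Only levels `≥ K` can violate the rules. Replace
each of them by the minimum of `c` and of the gaps between plus signs of such levels, over the gaps
that end later: this makes the rules hold exactly, without touching any sign or any level below
`K`, and the new levels have the same truncations at `N` as the old ones from some time on.
-/

namespace SLimit

section Levels

/-- Truncation at a finite level is locally constant because the only non-isolated point `⊤` has
the neighbourhood `[N, ⊤]`, on which the truncation equals `N`. -/
theorem isLocallyConstant_min_natCast (N : ℕ) : IsLocallyConstant fun k : ℕ∞ => min k N := by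
  refine (IsLocallyConstant.iff_eventually_eq _).2 fun k => ?_
  rcases eq_or_ne k ⊤ with rfl | hk
  · filter_upwards [Ioi_mem_nhds (ENat.natCast_lt_top N)] with m hm
    rw [min_eq_right (Set.mem_Ioi.1 hm).le, min_eq_right le_top]
  · rw [ENat.nhds_eq_pure hk]
    exact rfl

theorem isOpen_setOf_natCast_le (N : ℕ) : IsOpen {k : ℕ∞ | N ≤ k} := by
  simpa only [min_eq_right_iff] using (isLocallyConstant_min_natCast N).isOpen_fiber N

theorem continuous_of_tendsto_natCast {X : Type*} [TopologicalSpace X] {v : ℕ∞ → X}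
    (hv : Tendsto (fun n : ℕ => v n) atTop (𝓝 (v ⊤))) : Continuous v := by
  refine continuous_iff_continuousAt.2 fun k => ?_
  rcases eq_or_ne k ⊤ with rfl | hk
  · intro U hU
    obtain ⟨N, hN⟩ := eventually_atTop.1 (hv hU)
    refine mem_map.2 (mem_of_superset (Ioi_mem_nhds (ENat.natCast_lt_top N)) fun m hm => ?_)
    induction m using ENat.recTopCoe with
    | top => exact Set.mem_preimage.2 (mem_of_mem_nhds hU)
    | coe m => exact hN m (by exact_mod_cast (Set.mem_Ioi.1 hm).le)
  · rw [ContinuousAt, ENat.nhds_eq_pure hk]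
    exact tendsto_pure_nhds _ _

theorem exists_forall_min_eq_imp_dist_lt {X : Type*} [PseudoMetricSpace X] {v : ℕ∞ → X}
    (hv : Continuous v) {ε : ℝ} (hε : 0 < ε) :
    ∃ N : ℕ, ∀ k k' : ℕ∞, min k N = min k' N → dist (v k) (v k') < ε := by
  obtain ⟨N, hN⟩ : ∃ N : ℕ, ∀ k : ℕ∞, N < k → dist (v k) (v ⊤) < ε / 2 := by
    have hnear := Metric.tendsto_nhds.1 (hv.tendsto ⊤) (ε / 2) (half_pos hε)
    obtain ⟨a, ha, hIoc⟩ := exists_Ioc_subset_of_mem_nhds hnear ⟨0, ENat.top_pos⟩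
    lift a to ℕ using ha.ne_top
    exact ⟨a, fun k hk => hIoc ⟨hk, le_top⟩⟩
  refine ⟨N + 1, fun k k' h => ?_⟩
  rcases lt_or_ge k (N + 1 : ℕ) with hk | hk
  · have hkk : k = k' := by grind
    rw [hkk, dist_self]
    exact hε
  · have hk' : (N + 1 : ℕ) ≤ k' := by grind
    have hlt : (N : ℕ∞) < (N + 1 : ℕ) := by exact_mod_cast N.lt_succ_self
    calc dist (v k) (v k') ≤ dist (v k) (v ⊤) + dist (v k') (v ⊤) := dist_triangle_right _ _ _
      _ < ε / 2 + ε / 2 := add_lt_add (hN k (hlt.trans_le hk)) (hN k' (hlt.trans_le hk'))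
      _ = ε := add_halves ε

theorem eventually_natCast_le_of_frequently {l : ℕ → ℕ∞} {N : ℕ}
    (hmono : ∀ᶠ i in atTop, min (l i) N ≤ min (l (i + 1)) N) (hl : ∃ᶠ i in atTop, N ≤ l i) :
    ∀ᶠ i in atTop, N ≤ l i := by
  obtain ⟨i₀, hi₀⟩ := eventually_atTop.1 hmono
  obtain ⟨i₁, hi₁, hl₁⟩ := frequently_atTop.1 hl i₀
  filter_upwards [eventually_ge_atTop i₁] with i hi
  induction i, hi using Nat.le_induction with
  | base => exact hl₁
  | succ i hi ih => exact min_eq_right ih ▸ (hi₀ i (hi₁.trans hi)).trans (min_le_left _ _)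

theorem exists_tendsto_of_eventually_min_le_succ {l : ℕ → ℕ∞}
    (hl : ∀ N : ℕ, ∀ᶠ i in atTop, min (l i) N ≤ min (l (i + 1)) N) :
    ∃ c, Tendsto l atTop (𝓝 c) := by
  refine ⟨liminf l atTop, tendsto_order.2
    ⟨fun a ha => eventually_lt_of_lt_liminf ha, fun a ha => ?_⟩⟩
  by_contra hfreq
  simp only [not_eventually, not_lt] at hfreq
  generalize hc : liminf l atTop = c at ha
  lift c to ℕ using ha.ne_top
  have hev : ∀ᶠ i in atTop, ((c + 1 : ℕ) : ℕ∞) ≤ l i :=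
    eventually_natCast_le_of_frequently (hl (c + 1)) <| hfreq.mono fun i hi => by
      exact_mod_cast (Order.add_one_le_of_lt ha).trans hi
  have hle : ((c + 1 : ℕ) : ℕ∞) ≤ c := hc ▸ le_liminf_of_le (by isBoundedDefault) hev
  exact c.not_succ_le_self (by exact_mod_cast hle)

theorem eventually_min_eq_of_tendsto {l : ℕ → ℕ∞} {c : ℕ∞} (hl : Tendsto l atTop (𝓝 c)) (N : ℕ) :
    ∀ᶠ i in atTop, min (l i) N = min c N :=
  hl.eventually ((isLocallyConstant_min_natCast N).eventually_eq c)

end Levels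

theorem exists_pos_forall_dist_lt_imp_eq {A M Y : Type*} [TopologicalSpace A] [CompactSpace A]
    [MetricSpace M] {e : A → M} (he : Continuous e) (hinj : Function.Injective e) {g : A → Y}
    (hg : IsLocallyConstant g) : ∃ r > 0, ∀ a a', dist (e a) (e a') < r → g a = g a' := by
  have hclosed : IsClosed {p : A × A | g p.1 ≠ g p.2} := by
    simpa only [eq_iff_iff, iff_true, Function.comp_apply] using
      ((hg.comp_continuous continuous_fst).comp₂ (hg.comp_continuous continuous_snd)
        (· ≠ ·)).isClosed_fiber True
  obtain ⟨r, hr, hle⟩ := hclosed.isCompact.exists_forall_le' (f := fun p => dist (e p.1) (e p.2))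
    (by fun_prop) (a := 0) fun p hp => dist_pos.2 fun h => hp (congrArg g (hinj h))
  refine ⟨r, hr, fun a a' h => ?_⟩
  by_contra hne
  exact (hle (a, a') hne).not_gt h

section Rules

/-- The rules of the subshift at position `i`, for a point written as a sequence of signs `b`
(`true` for `+`) and a sequence of levels `l`, level `k` standing for the absolute value `s_{k+1}`
and level `⊤` for the absolute value `1`. -/
structure FollowsRules (b : ℕ → Bool) (l : ℕ → ℕ∞) (i : ℕ) : Prop where
  le_succ : l i ≤ l (i + 1)
  sign_eq_false : b i = true → ∀ j : ℕ, j ≤ l i → b (i + j + 1) = false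
  level_eq : b i = true → ∀ j : ℕ, j ≤ l i → l (i + j + 1) = l i

namespace FollowsRules

variable {b b' : ℕ → Bool} {l l' : ℕ → ℕ∞} {i i' N p d : ℕ}

theorem min_natCast (h : FollowsRules b l i) (N : ℕ) :
    FollowsRules b (fun n => min (l n) N) i where
  le_succ := min_le_min_right _ h.le_succ
  sign_eq_false hb j hj := h.sign_eq_false hb j (hj.trans (min_le_left _ _))
  level_eq hb j hj := by rw [h.level_eq hb j (hj.trans (min_le_left _ _))]

theorem congr (h : FollowsRules b l i) (hN : l i ≤ N)
    (heq : ∀ n ≤ N + 1, b (i + n) = b' (i' + n) ∧ l (i + n) = l' (i' + n)) :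
    FollowsRules b' l' i' := by
  obtain ⟨hb₀, hl₀⟩ : b i = b' i' ∧ l i = l' i' := heq 0 (Nat.zero_le _)
  have hwindow : ∀ j : ℕ, j ≤ l i → j + 1 ≤ N + 1 := fun j hj =>
    Nat.succ_le_succ (by exact_mod_cast hj.trans hN)
  refine ⟨?_, fun hb j hj => ?_, fun hb j hj => ?_⟩
  · rw [← hl₀, ← (heq 1 (Nat.le_add_left _ _)).2]
    exact h.le_succ
  · rw [← hl₀] at hj
    exact (heq (j + 1) (hwindow j hj)).1 ▸ h.sign_eq_false (hb₀ ▸ hb) j hj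
  · rw [← hl₀] at hj ⊢
    exact (heq (j + 1) (hwindow j hj)).2 ▸ h.level_eq (hb₀ ▸ hb) j hj

theorem sign_succ_eq_false (h : FollowsRules b l i) (hb : b i = true) : b (i + 1) = false :=
  h.sign_eq_false hb 0 (by simp)

theorem level_le_gap (h : FollowsRules b l p) (hp : b p = true) (hq : b (p + d + 2) = true) :
    l p ≤ d := by
  by_contra! hd
  have hq' : b (p + d + 2) = false :=
    h.sign_eq_false hp (d + 1) (by exact_mod_cast Order.add_one_le_of_lt hd)
  exact Bool.false_ne_true (hq'.symm.trans hq)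

end FollowsRules

theorem isClosed_setOf_followsRules :
    IsClosed {z : (ℕ → Bool) × (ℕ → ℕ∞) | ∀ i, FollowsRules z.1 z.2 i} := by
  have hsign (n : ℕ) : Continuous fun z : (ℕ → Bool) × (ℕ → ℕ∞) => z.1 n := by fun_prop
  have hlevel (n : ℕ) : Continuous fun z : (ℕ → Bool) × (ℕ → ℕ∞) => z.2 n := by fun_prop
  have hplus (n : ℕ) : IsOpen {z : (ℕ → Bool) × (ℕ → ℕ∞) | z.1 n = true} :=
    (isOpen_discrete {true}).preimage (hsign n)
  have hle (n j : ℕ) : IsOpen {z : (ℕ → Bool) × (ℕ → ℕ∞) | j ≤ z.2 n} :=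
    (isOpen_setOf_natCast_le j).preimage (hlevel n)
  have heq : {z : (ℕ → Bool) × (ℕ → ℕ∞) | ∀ i, FollowsRules z.1 z.2 i} =
      ⋂ i : ℕ, {z | z.2 i ≤ z.2 (i + 1)} ∩ ⋂ j : ℕ, {z | z.1 i = true ∧ (j : ℕ∞) ≤ z.2 i →
        z.1 (i + j + 1) = false ∧ z.2 (i + j + 1) = z.2 i} := by
    ext z
    simp only [Set.mem_iInter, Set.mem_inter_iff]
    exact forall_congr' fun i =>
      ⟨fun h => ⟨h.le_succ, fun j hj => ⟨h.sign_eq_false hj.1 j hj.2, h.level_eq hj.1 j hj.2⟩⟩,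
        fun h => ⟨h.1, fun hb j hj => (h.2 j ⟨hb, hj⟩).1, fun hb j hj => (h.2 j ⟨hb, hj⟩).2⟩⟩
  rw [heq]
  exact isClosed_iInter fun i => (isClosed_le (hlevel _) (hlevel _)).inter <|
    isClosed_iInter fun j => isClosed_imp ((hplus i).inter (hle i j)) <|
      (isClosed_eq (hsign _) continuous_const).inter (isClosed_eq (hlevel _) (hlevel _))

end Rules

section Correction

/-- The largest level that plus signs at the positions `A` may carry from `i` on: a plus sign at
`p` that is followed by another one at `q = p + d + 2` has level at most `d`, and only pairs with
`i < q` are taken into account. -/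
noncomputable def gapBound (A : Set ℕ) (i : ℕ) : ℕ∞ :=
  ⨅ (p : ℕ) (d : ℕ) (_ : p ∈ A ∧ p + d + 2 ∈ A ∧ i < p + d + 2), (d : ℕ∞)

variable {A : Set ℕ} {i j p d : ℕ}

theorem gapBound_le (hp : p ∈ A) (hq : p + d + 2 ∈ A) (hi : i < p + d + 2) : gapBound A i ≤ d :=
  iInf₂_le_of_le p d (iInf_le _ ⟨hp, hq, hi⟩)

theorem le_gapBound {k : ℕ∞}
    (hk : ∀ p d : ℕ, p ∈ A → p + d + 2 ∈ A → i < p + d + 2 → k ≤ d) : k ≤ gapBound A i :=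
  le_iInf₂ fun p d => le_iInf fun h => hk p d h.1 h.2.1 h.2.2

theorem monotone_gapBound (A : Set ℕ) : Monotone (gapBound A) := fun _ _ hij =>
  le_gapBound fun _ _ hp hq hi => gapBound_le hp hq (hij.trans_lt hi)

theorem notMem_of_le_gapBound (hi : i ∈ A) (hsucc : i + 1 ∉ A) (hj : j ≤ gapBound A i) :
    i + j + 1 ∉ A := by
  cases j with
  | zero => exact hsucc
  | succ d =>
    intro hmem
    have hle : ((d + 1 : ℕ) : ℕ∞) ≤ d := hj.trans (gapBound_le hi hmem (by omega))
    exact d.not_succ_le_self (by exact_mod_cast hle)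

theorem gapBound_add_eq (hi : i ∈ A) (hsucc : i + 1 ∉ A) (hj : j ≤ gapBound A i) :
    gapBound A (i + j + 1) = gapBound A i := by
  refine le_antisymm (le_gapBound fun p d hp hq hiq => gapBound_le hp hq ?_)
    (monotone_gapBound A (by omega))
  by_contra! hqj
  obtain ⟨t, ht⟩ : ∃ t, p + d + 2 = i + t + 1 := ⟨p + d + 1 - i, by omega⟩
  have htj : (t : ℕ∞) ≤ j := by exact_mod_cast (by omega : t ≤ j)
  exact notMem_of_le_gapBound hi hsucc (htj.trans hj) (ht ▸ hq)

/-- The positions of the plus signs of level at least `K`. -/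
def highPlus (b : ℕ → Bool) (l : ℕ → ℕ∞) (K : ℕ) : Set ℕ := {p | b p = true ∧ K ≤ l p}

/-- The correction of a sequence of levels `l` with limit `c`: levels below `K` are kept, the other
ones are replaced by the limit level as far as the gaps between the plus signs allow. -/
noncomputable def correctedLevel (b : ℕ → Bool) (l : ℕ → ℕ∞) (K : ℕ) (c : ℕ∞) (i : ℕ) : ℕ∞ :=
  if l i < K then l i else min c (gapBound (highPlus b l K) i)

variable {b : ℕ → Bool} {l : ℕ → ℕ∞} {K : ℕ} {c : ℕ∞}

theorem correctedLevel_of_lt (hi : l i < K) : correctedLevel b l K c i = l i := if_pos hi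

theorem correctedLevel_of_le (hi : K ≤ l i) :
    correctedLevel b l K c i = min c (gapBound (highPlus b l K) i) := if_neg hi.not_gt

theorem natCast_le_of_le_of_followsRules (hK : ∀ i, FollowsRules b (fun n => min (l n) K) i)
    (hij : i ≤ j) (hi : K ≤ l i) : K ≤ l j := by
  have hmono : Monotone fun n => min (l n) (K : ℕ∞) :=
    monotone_nat_of_le_succ fun n => (hK n).le_succ
  exact (le_min hi le_rfl).trans ((hmono hij).trans (min_le_left _ _))

theorem natCast_le_correctedLevel (hK : ∀ i, FollowsRules b (fun n => min (l n) K) i)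
    (hc : Tendsto l atTop (𝓝 c)) (hi : K ≤ l i) : K ≤ correctedLevel b l K c i := by
  rw [correctedLevel_of_le hi]
  refine le_min (ge_of_tendsto hc ?_) (le_gapBound fun p d hp hq _ => ?_)
  · filter_upwards [eventually_ge_atTop i] with j hij
    exact natCast_le_of_le_of_followsRules hK hij hi
  · exact min_eq_right hp.2 ▸ (hK p).level_le_gap hp.1 hq.1

theorem min_correctedLevel (hK : ∀ i, FollowsRules b (fun n => min (l n) K) i)
    (hc : Tendsto l atTop (𝓝 c)) (i : ℕ) : min (correctedLevel b l K c i) K = min (l i) K := by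
  rcases lt_or_ge (l i) K with hi | hi
  · rw [correctedLevel_of_lt hi]
  · rw [min_eq_right hi, min_eq_right (natCast_le_correctedLevel hK hc hi)]

theorem followsRules_correctedLevel_of_lt (hK : ∀ i, FollowsRules b (fun n => min (l n) K) i)
    (hc : Tendsto l atTop (𝓝 c)) (hi : l i < K) : FollowsRules b (correctedLevel b l K c) i := by
  have hLi : correctedLevel b l K c i = l i := correctedLevel_of_lt hi
  have htrunc : ∀ n, min (correctedLevel b l K c n) K = min (l n) K := min_correctedLevel hK hc
  have hj_le {j : ℕ} (hj : j ≤ correctedLevel b l K c i) : j ≤ min (l i) K := by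
    rwa [min_eq_left hi.le, ← hLi]
  refine ⟨?_, fun hb j hj => (hK i).sign_eq_false hb j (hj_le hj), fun hb j hj => ?_⟩
  · calc correctedLevel b l K c i = min (l i) K := by rw [hLi, min_eq_left hi.le]
      _ ≤ min (l (i + 1)) K := (hK i).le_succ
      _ ≤ correctedLevel b l K c (i + 1) := htrunc (i + 1) ▸ min_le_left _ _
  · have heq : min (correctedLevel b l K c (i + j + 1)) K = l i := by
      rw [htrunc, (hK i).level_eq hb j (hj_le hj), min_eq_left hi.le]
    rcases min_choice (correctedLevel b l K c (i + j + 1)) (K : ℕ∞) with h | h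
    · rw [hLi, ← heq, h]
    · exact absurd (h.symm.trans heq) hi.ne'

theorem followsRules_correctedLevel_of_le (hK : ∀ i, FollowsRules b (fun n => min (l n) K) i)
    (hi : K ≤ l i) : FollowsRules b (correctedLevel b l K c) i := by
  have hL {n : ℕ} (hin : i ≤ n) :
      correctedLevel b l K c n = min c (gapBound (highPlus b l K) n) :=
    correctedLevel_of_le (natCast_le_of_le_of_followsRules hK hin hi)
  have hsucc (hb : b i = true) : i + 1 ∉ highPlus b l K := fun h =>
    Bool.false_ne_true (((hK i).sign_succ_eq_false hb).symm.trans h.1)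
  have hj_le {j : ℕ} (hj : j ≤ correctedLevel b l K c i) : j ≤ gapBound (highPlus b l K) i :=
    (hL le_rfl ▸ hj).trans (min_le_right _ _)
  have hmem (hb : b i = true) : i ∈ highPlus b l K := ⟨hb, hi⟩
  refine ⟨?_, fun hb j hj => ?_, fun hb j hj => ?_⟩
  · rw [hL le_rfl, hL i.le_succ]
    exact min_le_min_left _ (monotone_gapBound _ i.le_succ)
  · have hnot := notMem_of_le_gapBound (hmem hb) (hsucc hb) (hj_le hj)
    exact Bool.eq_false_iff.2 fun hb' =>
      hnot ⟨hb', natCast_le_of_le_of_followsRules hK (by omega) hi⟩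
  · rw [hL (by omega), hL le_rfl, gapBound_add_eq (hmem hb) (hsucc hb) (hj_le hj)]

/-- A gap that starts before the rules hold up to level `N` is long once it ends late enough; a gap
that starts afterwards is bounded by the rules, up to level `N`. -/
theorem eventually_min_le_gapBound {N : ℕ}
    (hN : ∀ᶠ i in atTop, FollowsRules b (fun n => min (l n) N) i)
    (hc : Tendsto l atTop (𝓝 c)) :
    ∀ᶠ i in atTop, min c N ≤ gapBound (highPlus b l K) i := by
  obtain ⟨i₀, hi₀⟩ := eventually_atTop.1 (hN.and (eventually_min_eq_of_tendsto hc N))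
  filter_upwards [eventually_ge_atTop (i₀ + N + 2)] with i hi
  refine le_gapBound fun p d hp hq hiq => ?_
  rcases lt_or_ge p i₀ with hp₀ | hp₀
  · exact (min_le_right _ _).trans (by exact_mod_cast (by omega : N ≤ d))
  · obtain ⟨hrules, hlim⟩ := hi₀ p hp₀
    exact hlim ▸ hrules.level_le_gap hp.1 hq.1

theorem eventually_min_correctedLevel_eq {N : ℕ}
    (hN : ∀ᶠ i in atTop, FollowsRules b (fun n => min (l n) N) i)
    (hc : Tendsto l atTop (𝓝 c)) :
    ∀ᶠ i in atTop, min (correctedLevel b l K c i) N = min (l i) N := by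
  filter_upwards [eventually_min_le_gapBound (K := K) hN hc, eventually_min_eq_of_tendsto hc N]
    with i hgap hlim
  rcases lt_or_ge (l i) K with hi | hi
  · rw [correctedLevel_of_lt hi]
  · rw [correctedLevel_of_le hi, hlim, min_right_comm, min_eq_left hgap]

theorem exists_followsRules_of_eventually_followsRules
    (hK : ∀ i, FollowsRules b (fun n => min (l n) K) i)
    (h : ∀ N : ℕ, ∀ᶠ i in atTop, FollowsRules b (fun n => min (l n) N) i) :
    ∃ L : ℕ → ℕ∞, (∀ i, FollowsRules b L i) ∧ (∀ i, min (L i) K = min (l i) K) ∧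
      ∀ N : ℕ, ∀ᶠ i in atTop, min (L i) N = min (l i) N := by
  obtain ⟨c, hc⟩ := exists_tendsto_of_eventually_min_le_succ fun N =>
    (h N).mono fun _ hi => hi.le_succ
  exact ⟨correctedLevel b l K c,
    fun i => (lt_or_ge (l i) K).elim (followsRules_correctedLevel_of_lt hK hc)
      (followsRules_correctedLevel_of_le hK),
    min_correctedLevel hK hc, fun N => eventually_min_correctedLevel_eq (h N) hc⟩

end Correction

section Letters

/-- The standing assumptions on the sequence `s_1, s_2, …`. -/
structure Admissible (s : ℕ → ℝ) : Prop where
  pos : 0 < s 1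
  lt : ∀ k : ℕ, 1 ≤ k → s k < s (k + 1)
  lim : Tendsto s atTop (𝓝 1)

/-- The absolute values of the letters of the alphabet, indexed by `ℕ∞` such that level `0` is the
first one, `s_1`. -/
noncomputable def level (s : ℕ → ℝ) (k : ℕ∞) : ℝ := ENat.recTopCoe 1 (fun n => s (n + 1)) k

/-- The letter with sign `b`, where `true` stands for `+`, and level `k`. -/
noncomputable def letter (s : ℕ → ℝ) (b : Bool) (k : ℕ∞) : ℝ := bif b then level s k else -level s k

/-- The point with signs `b` and levels `l`. The projection to `[-1, 1]` has no effect for an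
admissible sequence `s`. -/
noncomputable def decode (s : ℕ → ℝ) (b : ℕ → Bool) (l : ℕ → ℕ∞) : SeqSpace := fun n =>
  Set.projIcc (-1 : ℝ) 1 (by norm_num) (letter s (b n) (l n))

@[simp] theorem level_top (s : ℕ → ℝ) : level s ⊤ = 1 := rfl

@[simp] theorem level_natCast (s : ℕ → ℝ) (n : ℕ) : level s n = s (n + 1) := rfl

@[simp] theorem letter_true (s : ℕ → ℝ) (k : ℕ∞) : letter s true k = level s k := rfl

@[simp] theorem letter_false (s : ℕ → ℝ) (k : ℕ∞) : letter s false k = -level s k := rfl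

variable {s : ℕ → ℝ}

theorem dist_letter_letter (b : Bool) (k k' : ℕ∞) :
    dist (letter s b k) (letter s b k') = dist (level s k) (level s k') := by
  cases b
  · exact dist_neg_neg _ _
  · rfl

theorem continuous_level (hs : Tendsto s atTop (𝓝 1)) : Continuous (level s) :=
  continuous_of_tendsto_natCast ((tendsto_add_atTop_iff_nat 1).2 hs)

theorem continuous_letter (hs : Tendsto s atTop (𝓝 1)) :
    Continuous fun p : Bool × ℕ∞ => letter s p.1 p.2 :=
  continuous_prod_of_discrete_left.2 fun b => by
    cases b
    · exact (continuous_level hs).neg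
    · exact continuous_level hs

theorem mem_alphabet_iff {a : ℝ} : a ∈ alphabet s ↔ ∃ b k, a = letter s b k := by
  constructor
  · rintro (((rfl | rfl) | ⟨k, hk, rfl⟩) | ⟨k, hk, rfl⟩)
    · exact ⟨false, ⊤, rfl⟩
    · exact ⟨true, ⊤, rfl⟩
    · exact ⟨false, (k - 1 : ℕ), by rw [letter_false, level_natCast, Nat.sub_add_cancel hk]⟩
    · exact ⟨true, (k - 1 : ℕ), by rw [letter_true, level_natCast, Nat.sub_add_cancel hk]⟩
  · rintro ⟨b, k, rfl⟩
    cases k using ENat.recTopCoe with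
    | top => cases b <;> simp [alphabet]
    | coe n =>
      cases b
      · exact Or.inl (Or.inr ⟨n + 1, n.succ_pos, rfl⟩)
      · exact Or.inr ⟨n + 1, n.succ_pos, rfl⟩

namespace Admissible

theorem strictMono_level (hs : Admissible s) : StrictMono (level s) := by
  have hmono : StrictMono fun n => s (n + 1) :=
    strictMono_nat_of_lt_succ fun n => hs.lt (n + 1) n.succ_pos
  have hlt_one (n : ℕ) : s (n + 1) < 1 :=
    (hmono n.lt_succ_self).trans_le
      (hmono.monotone.ge_of_tendsto ((tendsto_add_atTop_iff_nat 1).2 hs.lim) _)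
  intro k k' hk
  lift k to ℕ using hk.ne_top
  cases k' using ENat.recTopCoe with
  | top => exact hlt_one k
  | coe k' => exact hmono (by exact_mod_cast hk)

theorem level_pos (hs : Admissible s) (k : ℕ∞) : 0 < level s k :=
  hs.pos.trans_le (hs.strictMono_level.monotone (zero_le : (0 : ℕ∞) ≤ k))

theorem level_le_one (hs : Admissible s) (k : ℕ∞) : level s k ≤ 1 :=
  hs.strictMono_level.monotone le_top

theorem abs_letter (hs : Admissible s) (b : Bool) (k : ℕ∞) : |letter s b k| = level s k := by
  cases b <;> simp [abs_of_pos (hs.level_pos k)]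

theorem letter_inj (hs : Admissible s) {b b' : Bool} {k k' : ℕ∞} :
    letter s b k = letter s b' k' ↔ b = b' ∧ k = k' := by
  refine ⟨fun h => ?_, fun ⟨hb, hk⟩ => hb ▸ hk ▸ rfl⟩
  obtain rfl : k = k' := hs.strictMono_level.injective (by
    rw [← hs.abs_letter b k, ← hs.abs_letter b' k', h])
  have hne : level s k ≠ -level s k := by linarith [hs.level_pos k]
  refine ⟨?_, rfl⟩
  cases b <;> cases b'
  · rfl
  · exact absurd h.symm hne
  · exact absurd h hne
  · rfl

theorem exists_pos_forall_dist_letter_lt (hs : Admissible s) (N : ℕ) :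
    ∃ r > 0, ∀ b b' k k', dist (letter s b k) (letter s b' k') < r →
      b = b' ∧ min k (N : ℕ∞) = min k' N := by
  have hinj : Function.Injective fun p : Bool × ℕ∞ => letter s p.1 p.2 := fun _ _ h =>
    Prod.ext_iff.2 (hs.letter_inj.1 h)
  have htrunc : IsLocallyConstant fun p : Bool × ℕ∞ => (p.1, min p.2 N) :=
    ((IsLocallyConstant.of_discrete id).comp_continuous continuous_fst).prodMk
      ((isLocallyConstant_min_natCast N).comp_continuous continuous_snd)
  obtain ⟨r, hr, hsep⟩ := exists_pos_forall_dist_lt_imp_eq (continuous_letter hs.lim) hinj htrunc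
  exact ⟨r, hr, fun b b' k k' h => Prod.ext_iff.1 (hsep (b, k) (b', k') h)⟩

theorem coord_decode (hs : Admissible s) (b : ℕ → Bool) (l : ℕ → ℕ∞) (n : ℕ) :
    (decode s b l).coord n = letter s (b n) (l n) :=
  congrArg Subtype.val <| Set.projIcc_of_mem (by norm_num) <|
    abs_le.1 ((hs.abs_letter _ _).trans_le (hs.level_le_one _))

theorem decode_mem_subshift (hs : Admissible s) {b : ℕ → Bool} {l : ℕ → ℕ∞}
    (h : ∀ i, FollowsRules b l i) : decode s b l ∈ subshift s := by
  have hplus {n : ℕ} {k : ℕ∞} (hn : (decode s b l).coord n = level s k) : b n = true ∧ l n = k :=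
    hs.letter_inj.1 ((hs.coord_decode b l n).symm.trans hn)
  have hafter {n j : ℕ} {k : ℕ∞} (hn : (decode s b l).coord n = level s k) (hj : j ≤ k) :
      (decode s b l).coord (n + j + 1) = -level s k := by
    obtain ⟨hb, rfl⟩ := hplus hn
    rw [hs.coord_decode, (h n).sign_eq_false hb j hj, (h n).level_eq hb j hj, letter_false]
  refine ⟨fun n => ?_, fun n => ?_, fun n k hk hn j hj hjk => ?_, fun n hn j hj => ?_⟩
  · exact mem_alphabet_iff.2 ⟨_, _, hs.coord_decode b l n⟩
  · rw [hs.coord_decode, hs.coord_decode, hs.abs_letter, hs.abs_letter]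
    exact hs.strictMono_level.monotone (h n).le_succ
  · obtain ⟨k, rfl⟩ := Nat.exists_eq_add_of_le' hk
    obtain ⟨j, rfl⟩ := Nat.exists_eq_add_of_le' hj
    exact hafter (k := k) hn (by exact_mod_cast Nat.le_of_succ_le_succ hjk)
  · obtain ⟨j, rfl⟩ := Nat.exists_eq_add_of_le' hj
    exact hafter (k := ⊤) hn le_top

theorem exists_decode_eq (hs : Admissible s) {x : SeqSpace} (hx : x ∈ subshift s) :
    ∃ b l, (∀ i, FollowsRules b l i) ∧ decode s b l = x := by
  obtain ⟨halphabet, habs, hfinite, htop⟩ := hx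
  choose b l hbl using fun n => mem_alphabet_iff.1 (halphabet n)
  have hafter {n j : ℕ} (hb : b n = true) (hj : j ≤ l n) :
      b (n + j + 1) = false ∧ l (n + j + 1) = l n := by
    have hn : x.coord n = level s (l n) := by rw [hbl, hb, letter_true]
    rw [← hs.letter_inj, ← hbl, letter_false, add_assoc]
    generalize l n = k at hn hj ⊢
    cases k using ENat.recTopCoe with
    | top => exact htop n hn (j + 1) j.succ_pos
    | coe k =>
      exact hfinite n (k + 1) k.succ_pos hn (j + 1) j.succ_pos
        (Nat.succ_le_succ (by exact_mod_cast hj))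
  refine ⟨b, l, fun n => ⟨?_, fun hb j hj => (hafter hb hj).1, fun hb j hj => (hafter hb hj).2⟩,
    funext fun n => Subtype.ext ((hs.coord_decode b l n).trans (hbl n).symm)⟩
  have habs_n := habs n
  rw [hbl, hbl, hs.abs_letter, hs.abs_letter] at habs_n
  exact hs.strictMono_level.le_iff_le.1 habs_n

end Admissible

end Letters

section SeqSpace

theorem dist_le_of_forall_abs_coord_sub_le {x y : SeqSpace} {N : ℕ} {ε : ℝ}
    (hN : (1 / 2 : ℝ) ^ N ≤ ε) (h : ∀ n < N, |x.coord n - y.coord n| ≤ ε) : dist x y ≤ ε := by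
  refine ciSup_le fun n => ?_
  rcases lt_or_ge n N with hn | hn
  · exact (mul_le_of_le_one_left (abs_nonneg _)
      (pow_le_one₀ (by norm_num) (by norm_num))).trans (h n hn)
  · calc (1 / 2 : ℝ) ^ (n + 1) * |x.coord n - y.coord n| ≤ (1 / 2) ^ (n + 1) * 2 := by
          gcongr
          exact x.abs_coord_sub_le y n
      _ = (1 / 2) ^ n := by ring
      _ ≤ (1 / 2) ^ N := pow_le_pow_of_le_one (by norm_num) (by norm_num) hn
      _ ≤ ε := hN

theorem abs_coord_sub_le_two_pow_mul_dist (x y : SeqSpace) (n : ℕ) :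
    |x.coord n - y.coord n| ≤ 2 ^ (n + 1) * dist x y := by
  rw [← div_le_iff₀' (by positivity), div_eq_inv_mul, ← inv_pow, ← one_div]
  exact le_seqDist x y n

theorem continuous_coord (n : ℕ) : Continuous fun x : SeqSpace => x.coord n := by
  refine (LipschitzWith.of_dist_le_mul (K := 2 ^ (n + 1)) fun x y => ?_).continuous
  exact_mod_cast abs_coord_sub_le_two_pow_mul_dist x y n

theorem continuous_of_continuous_coord {Z : Type*} [TopologicalSpace Z] {F : Z → SeqSpace}
    (hF : ∀ n, Continuous fun z => (F z).coord n) : Continuous F := by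
  refine continuous_iff_continuousAt.2 fun z => Metric.tendsto_nhds.2 fun ε hε => ?_
  obtain ⟨N, hN⟩ := exists_pow_lt_of_lt_one (half_pos hε) (by norm_num : (1 / 2 : ℝ) < 1)
  have hnear : ∀ᶠ w in 𝓝 z, ∀ n ∈ Set.Iio N, dist ((F w).coord n) ((F z).coord n) < ε / 2 :=
    (eventually_all_finite (Set.finite_Iio N)).2 fun n _ =>
      Metric.tendsto_nhds.1 (hF n).continuousAt _ (half_pos hε)
  filter_upwards [hnear] with w hw
  exact (dist_le_of_forall_abs_coord_sub_le hN.le fun n hn => (hw n hn).le).trans_lt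
    (half_lt_self hε)

theorem continuous_shift : Continuous shift :=
  continuous_of_continuous_coord fun n => continuous_coord (n + 1)

theorem coord_iterate_shift (x : SeqSpace) (i n : ℕ) :
    (shift^[i] x).coord n = x.coord (i + n) := by
  induction i generalizing x with
  | zero => rw [Function.iterate_zero_apply, zero_add]
  | succ i ih =>
    rw [Function.iterate_succ_apply, ih, Nat.succ_add]
    rfl

theorem continuous_subshiftMap (s : ℕ → ℝ) : Continuous (subshiftMap s) :=
  continuous_shift.restrict (mapsTo_shift s)

theorem Admissible.isCompact_subshift {s : ℕ → ℝ} (hs : Admissible s) :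
    IsCompact (subshift s) := by
  have hdecode : Continuous fun z : (ℕ → Bool) × (ℕ → ℕ∞) => decode s z.1 z.2 :=
    continuous_of_continuous_coord fun n => by
      simp only [hs.coord_decode]
      exact (continuous_letter hs.lim).comp (f := fun z : (ℕ → Bool) × (ℕ → ℕ∞) => (z.1 n, z.2 n))
        (by fun_prop)
  convert isClosed_setOf_followsRules.isCompact.image hdecode
  ext x
  constructor
  · intro hx
    obtain ⟨b, l, hrules, hx⟩ := hs.exists_decode_eq hx
    exact ⟨(b, l), hrules, hx⟩
  · rintro ⟨z, hrules, rfl⟩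
    exact hs.decode_mem_subshift hrules

end SeqSpace

section Shadowing

theorem abs_coord_sub_coord_zero_le {ξ : ℕ → SeqSpace} {δ : ℝ} {i : ℕ}
    (h : ∀ j ≥ i, dist (shift (ξ j)) (ξ (j + 1)) ≤ δ) (n : ℕ) :
    |(ξ i).coord n - (ξ (i + n)).coord 0| ≤ 2 ^ (n + 1) * δ := by
  have hδ : 0 ≤ δ := dist_nonneg.trans (h i le_rfl)
  induction n generalizing i with
  | zero => simpa using hδ
  | succ n ih =>
    have hstep : |(ξ i).coord (n + 1) - (ξ (i + 1)).coord n| ≤ 2 ^ (n + 1) * δ :=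
      (abs_coord_sub_le_two_pow_mul_dist (shift (ξ i)) (ξ (i + 1)) n).trans
        (mul_le_mul_of_nonneg_left (h i le_rfl) (by positivity))
    have hrest : |(ξ (i + 1)).coord n - (ξ (i + (n + 1))).coord 0| ≤ 2 ^ (n + 1) * δ := by
      rw [← add_assoc, add_right_comm]
      exact ih (i := i + 1) fun j hj => h j (i.le_succ.trans hj)
    calc |(ξ i).coord (n + 1) - (ξ (i + (n + 1))).coord 0|
        ≤ 2 ^ (n + 1) * δ + 2 ^ (n + 1) * δ :=
          (abs_sub_le _ _ _).trans (add_le_add hstep hrest)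
      _ = 2 ^ (n + 1 + 1) * δ := by ring

theorem exists_pos_forall_abs_coord_sub_coord_zero_lt (N : ℕ) {ε : ℝ} (hε : 0 < ε) :
    ∃ δ > 0, ∀ (ξ : ℕ → SeqSpace) (i : ℕ), (∀ j ≥ i, dist (shift (ξ j)) (ξ (j + 1)) ≤ δ) →
      ∀ n ≤ N, |(ξ i).coord n - (ξ (i + n)).coord 0| < ε := by
  refine ⟨ε / 2 ^ (N + 2), by positivity, fun ξ i h n hn => ?_⟩
  have hpow : (2 : ℝ) ^ (n + 1) < 2 ^ (N + 2) := pow_lt_pow_right₀ (by norm_num) (by omega)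
  calc |(ξ i).coord n - (ξ (i + n)).coord 0| ≤ 2 ^ (n + 1) * (ε / 2 ^ (N + 2)) :=
        abs_coord_sub_coord_zero_le h n
    _ < 2 ^ (N + 2) * (ε / 2 ^ (N + 2)) := by gcongr
    _ = ε := by field_simp

theorem exists_pos_forall_dist_iterate_shift_le {ε : ℝ} (hε : 0 < ε) :
    ∃ δ > 0, ∀ (ξ : ℕ → SeqSpace) (x : SeqSpace) (i : ℕ),
      (∀ j ≥ i, dist (shift (ξ j)) (ξ (j + 1)) ≤ δ) →
      (∀ j ≥ i, |x.coord j - (ξ j).coord 0| ≤ δ) → dist (shift^[i] x) (ξ i) ≤ ε := by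
  obtain ⟨N, hN⟩ := exists_pow_lt_of_lt_one hε (by norm_num : (1 / 2 : ℝ) < 1)
  obtain ⟨δ, hδ, hhead⟩ := exists_pos_forall_abs_coord_sub_coord_zero_lt N (half_pos hε)
  refine ⟨min δ (ε / 2), by positivity, fun ξ x i hξ hx => ?_⟩
  refine dist_le_of_forall_abs_coord_sub_le hN.le fun n hn => ?_
  rw [coord_iterate_shift]
  calc |x.coord (i + n) - (ξ i).coord n|
      ≤ |x.coord (i + n) - (ξ (i + n)).coord 0| + |(ξ (i + n)).coord 0 - (ξ i).coord n| :=
        abs_sub_le _ _ _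
    _ ≤ ε / 2 + ε / 2 := by
        refine add_le_add ((hx _ (Nat.le_add_right i n)).trans (min_le_right _ _)) ?_
        rw [abs_sub_comm]
        exact (hhead ξ i (fun j hj => (hξ j hj).trans (min_le_left _ _)) n hn.le).le
    _ = ε := add_halves ε

theorem tendsto_dist_iterate_shift {ξ : ℕ → SeqSpace} {x : SeqSpace}
    (hξ : Tendsto (fun i => dist (shift (ξ i)) (ξ (i + 1))) atTop (𝓝 0))
    (hx : Tendsto (fun i => |x.coord i - (ξ i).coord 0|) atTop (𝓝 0)) :
    Tendsto (fun i => dist (shift^[i] x) (ξ i)) atTop (𝓝 0) := by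
  refine tendsto_order.2 ⟨fun a ha => .of_forall fun _ => ha.trans_le dist_nonneg, fun ε hε => ?_⟩
  obtain ⟨δ, hδ, hshadow⟩ := exists_pos_forall_dist_iterate_shift_le (half_pos hε)
  filter_upwards [eventually_forall_ge_atTop.2 (hξ.eventually_le_const hδ),
    eventually_forall_ge_atTop.2 (hx.eventually_le_const hδ)] with i hξi hxi
  exact (hshadow ξ x i hξi hxi).trans_lt (half_lt_self hε)

namespace Admissible

variable {s : ℕ → ℝ}

theorem exists_pos_forall_followsRules_head (hs : Admissible s) (N : ℕ) :
    ∃ δ > 0, ∀ (b : ℕ → ℕ → Bool) (l : ℕ → ℕ → ℕ∞), (∀ j i, FollowsRules (b j) (l j) i) → ∀ i,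
      (∀ j ≥ i, dist (shift (decode s (b j) (l j))) (decode s (b (j + 1)) (l (j + 1))) ≤ δ) →
      FollowsRules (fun j => b j 0) (fun j => min (l j 0) N) i := by
  obtain ⟨r, hr, hsep⟩ := hs.exists_pos_forall_dist_letter_lt N
  obtain ⟨δ, hδ, hhead⟩ := exists_pos_forall_abs_coord_sub_coord_zero_lt (N + 1) hr
  refine ⟨δ, hδ, fun b l hrules i h => ((hrules i 0).min_natCast N).congr (min_le_right _ _) ?_⟩
  intro n hn
  rw [zero_add]
  have hclose := hhead (fun j => decode s (b j) (l j)) i h n hn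
  rw [hs.coord_decode, hs.coord_decode] at hclose
  exact hsep _ _ _ _ hclose

theorem exists_forall_min_eq_imp_abs_coord_sub_le (hs : Admissible s) {ε : ℝ} (hε : 0 < ε) :
    ∃ N : ℕ, ∀ (b b' : ℕ → Bool) (l l' : ℕ → ℕ∞) (n m : ℕ), b n = b' m →
      min (l n) N = min (l' m) N → |(decode s b l).coord n - (decode s b' l').coord m| ≤ ε := by
  obtain ⟨N, hN⟩ := exists_forall_min_eq_imp_dist_lt (continuous_level hs.lim) hε
  refine ⟨N, fun b b' l l' n m hb hl => ?_⟩
  rw [hs.coord_decode, hs.coord_decode, hb, ← Real.dist_eq, dist_letter_letter]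
  exact (hN _ _ hl).le

theorem exists_mem_subshift_abs_coord_sub_coord_zero_le (hs : Admissible s) {ε : ℝ} (hε : 0 < ε) :
    ∃ δ > 0, ∀ ξ : ℕ → SeqSpace, (∀ i, ξ i ∈ subshift s) → IsLimitPseudoOrbit shift δ ξ →
      ∃ x ∈ subshift s, (∀ i, |x.coord i - (ξ i).coord 0| ≤ ε) ∧
        Tendsto (fun i => |x.coord i - (ξ i).coord 0|) atTop (𝓝 0) := by
  obtain ⟨K, hK⟩ := hs.exists_forall_min_eq_imp_abs_coord_sub_le hε
  obtain ⟨δ, hδ, hrules⟩ := hs.exists_pos_forall_followsRules_head K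
  refine ⟨δ, hδ, fun ξ hξ ⟨hle, hlim⟩ => ?_⟩
  choose b l hcode hdecode using fun i => hs.exists_decode_eq (hξ i)
  obtain rfl : (fun i => decode s (b i) (l i)) = ξ := funext hdecode
  have heventually (N : ℕ) :
      ∀ᶠ i in atTop, FollowsRules (fun j => b j 0) (fun j => min (l j 0) N) i := by
    obtain ⟨η, hη, hrulesN⟩ := hs.exists_pos_forall_followsRules_head N
    filter_upwards [eventually_forall_ge_atTop.2 (hlim.eventually_le_const hη)] with i hi
    exact hrulesN b l hcode i hi
  obtain ⟨L, hL, hLK, hLlim⟩ := exists_followsRules_of_eventually_followsRules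
    (fun i => hrules b l hcode i fun j _ => hle j) heventually
  refine ⟨decode s (fun i => b i 0) L, hs.decode_mem_subshift hL,
    fun i => hK _ _ _ _ i 0 rfl (hLK i), tendsto_order.2
      ⟨fun a ha => .of_forall fun _ => ha.trans_le (abs_nonneg _), fun θ hθ => ?_⟩⟩
  obtain ⟨N, hN⟩ := hs.exists_forall_min_eq_imp_abs_coord_sub_le (half_pos hθ)
  filter_upwards [hLlim N] with i hi
  exact (hN _ _ _ _ i 0 rfl hi).trans_lt (half_lt_self hθ)

theorem hasSLimitShadowing_subshiftMap (hs : Admissible s) :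
    HasSLimitShadowing (subshiftMap s) := by
  intro ε hε
  obtain ⟨δ, hδ, hshadow⟩ := exists_pos_forall_dist_iterate_shift_le hε
  obtain ⟨η, hη, hfollow⟩ := hs.exists_mem_subshift_abs_coord_sub_coord_zero_le hδ
  refine ⟨min δ η, lt_min hδ hη, fun ξ ⟨hle, hlim⟩ => ?_⟩
  obtain ⟨x, hx, hxδ, hxlim⟩ := hfollow (fun i => ξ i) (fun i => (ξ i).2)
    ⟨fun i => (hle i).trans (min_le_right _ _), hlim⟩
  have hdist (i : ℕ) : dist ((subshiftMap s)^[i] ⟨x, hx⟩) (ξ i) = dist (shift^[i] x) (ξ i) :=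
    congrArg (dist · (ξ i : SeqSpace)) ((mapsTo_shift s).coe_iterate_restrict ⟨x, hx⟩ i)
  refine ⟨⟨x, hx⟩, fun i => ?_, ?_⟩
  · rw [hdist]
    exact hshadow (fun j => ξ j) x i (fun j _ => (hle j).trans (min_le_left _ _)) fun j _ => hxδ j
  · simp only [hdist]
    exact tendsto_dist_iterate_shift hlim hxlim

end Admissible

end Shadowing

end SLimit

theorem mainTheorem8 (s : ℕ → ℝ) (hs_pos : 0 < s 1) (hs_lt : ∀ k : ℕ, 1 ≤ k → s k < s (k + 1))
    (hs_lim : Filter.Tendsto s Filter.atTop (nhds 1)) :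
    IsCompact (SLimit.subshift s) ∧ Continuous (SLimit.subshiftMap s) ∧
      SLimit.HasSLimitShadowing (SLimit.subshiftMap s) := by
  have hs : SLimit.Admissible s := ⟨hs_pos, hs_lt, hs_lim⟩
  exact ⟨hs.isCompact_subshift, SLimit.continuous_subshiftMap s, hs.hasSLimitShadowing_subshiftMap⟩
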